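/- Let $X$ be a non-empty finite set with the discrete topology (equivalently, a non-empty compact Hausdorff space with finitely many points), let $\sigma : X \to X$ be a homeomorphism, and put $\Sigma = (X,\sigma)$. Let $\alpha$ be the automorphism $f \mapsto f\circ\sigma^{-1}$ of the algebra $C(X)$ of complex-valued continuous functions on $X$, which carries the supremum norm. Let $\ell^1(\Sigma)$ be the unital complex Banach algebra of all $a : \mathbb{Z} \to C(X)$ with $\|a\| = \sum_{n\in\mathbb{Z}} \|a(n)\| < \infty$, with twisted convolution $$(aa')(n) = \sum_{k\in\mathbb{Z}} a(k)\cdot \alpha^k(a'(n-k)) \qquad (n \in \mathbb{Z})$$ as multiplication. A representation of $\ell^1(\Sigma)$ on a complex vector space $E$ is an algebra homomorphism $\pi$ from $\ell^1(\Sigma)$ to the linear operators on $E$; it is algebraically irreducible if $\pi(\ell^1(\Sigma))(E) \neq \{0\}$ and the only invariant linear subspaces of $E$ are $\{0\}$ and $E$. The structure space $\Pi$ of $\ell^1(\Sigma)$ is the set of primitive ideals of $\ell^1(\Sigma)$, i.e. of kernels of algebraically irreducible representations, with the hull-kernel topology, in which the closure of $S \subset \Pi$ is $\{P \in \Pi :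 P \supset \bigcap_{Q\in S} Q\}$. Then $\Pi$ is homeomorphic to the topological disjoint union $\bigsqcup_{\mathfrak{o}} \mathbb{T}$ of copies of the unit circle $\mathbb{T} = \{z\in\mathbb{C} : |z| = 1\}$, one copy for each orbit $\mathfrak{o} = \{\sigma^n(x) : n\in\mathbb{Z}\}$, $x \in X$, of $\sigma$ in $X$. -/

import Mathlib

open scoped ENNReal

universe u

/-! ### The structure space of a complex algebra -/

section StructureSpace

/-- A representation `π : A → L(E)` of a (not necessarily unital) complex algebra on a complex
vector space is algebraically irreducible if `π(A)(E) ≠ {0}` and the only `π(A)`-invariant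
linear subspaces of `E` are `{0}` and `E`. No topology on `E` is involved. -/
structure IsAlgebraicallyIrreducible {A E : Type*} [NonUnitalRing A] [Module ℂ A]
    [AddCommGroup E] [Module ℂ E] (π : A →ₙₐ[ℂ] Module.End ℂ E) : Prop where
  nonzero : ∃ a x, π a x ≠ 0
  eq_bot_or_eq_top : ∀ W : Submodule ℂ E, (∀ a, ∀ x ∈ W, π a x ∈ W) → W = ⊥ ∨ W = ⊤

/-- A two-sided ideal is primitive if it is the kernel of an algebraically irreducible
representation on some complex vector space `E`. (Letting `E` live in the universe of `A` is no
restriction, since `E` is isomorphic to a quotient of `A`.) -/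
def IsPrimitiveIdeal {A : Type u} [NonUnitalRing A] [Module ℂ A] (P : TwoSidedIdeal A) : Prop :=
  ∃ (E : Type u) (_ : AddCommGroup E) (_ : Module ℂ E) (π : A →ₙₐ[ℂ] Module.End ℂ E),
    IsAlgebraicallyIrreducible π ∧ P = TwoSidedIdeal.ker π

/-- The set of primitive ideals of a complex algebra. -/
def StructureSpace (A : Type u) [NonUnitalRing A] [Module ℂ A] : Type u :=
  {P : TwoSidedIdeal A // IsPrimitiveIdeal P}

namespace StructureSpace

variable {A : Type u} [NonUnitalRing A] [Module ℂ A]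

/-- The kernel of a set of primitive ideals: their intersection. -/
def kernel (S : Set (StructureSpace A)) : TwoSidedIdeal A :=
  sInf (Subtype.val '' S)

/-- The hull of an ideal: the set of primitive ideals containing it. -/
def hull (I : TwoSidedIdeal A) : Set (StructureSpace A) :=
  {P | I ≤ P.1}

theorem mem_kernel {S : Set (StructureSpace A)} {a : A} :
    a ∈ kernel S ↔ ∀ P ∈ S, a ∈ P.1 := by
  rw [kernel, TwoSidedIdeal.mem_sInf]
  constructor
  · intro h P hP
    exact h P.1 ⟨P, hP, rfl⟩
  · rintro h _ ⟨P, hP, rfl⟩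
    exact h P hP

theorem subset_hull_kernel (S : Set (StructureSpace A)) : S ⊆ hull (kernel S) :=
  fun _ hP _ ha => mem_kernel.1 ha _ hP

theorem kernel_anti {S T : Set (StructureSpace A)} (h : S ⊆ T) : kernel T ≤ kernel S :=
  fun _ ha => mem_kernel.2 fun P hP => mem_kernel.1 ha P (h hP)

/-- A primitive ideal is prime; this makes finite unions of hull-kernel closed sets closed. -/
theorem le_or_le_of_inf_le {I J : TwoSidedIdeal A} (P : StructureSpace A)
    (h : ∀ a, a ∈ I → a ∈ J → a ∈ P.1) : I ≤ P.1 ∨ J ≤ P.1 := by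
  obtain ⟨P, E, _, _, π, hπ, rfl⟩ := P
  by_contra! hn
  obtain ⟨hI, hJ⟩ := hn
  obtain ⟨b, hbJ, hb⟩ := Set.not_subset.1 hJ
  have hb' : π b ≠ 0 := fun h0 => hb ((TwoSidedIdeal.mem_ker π).2 h0)
  obtain ⟨x, hx⟩ : ∃ x, π b x ≠ 0 := by
    by_contra! h0
    exact hb' (LinearMap.ext h0)
  let W : Submodule ℂ E := ⨅ a : I, LinearMap.ker (π a.1)
  have memW : ∀ y, y ∈ W ↔ ∀ a ∈ I, π a y = 0 := fun y => by
    simp [W, Submodule.mem_iInf]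
  have hW : ∀ a, ∀ y ∈ W, π a y ∈ W := fun a y hy => by
    rw [memW] at hy ⊢
    intro c hc
    have := hy (c * a) (I.mul_mem_right c a hc)
    rwa [map_mul] at this
  have hbx : π b x ∈ W := by
    rw [memW]
    intro c hc
    have := h (c * b) (I.mul_mem_right c b hc) (J.mul_mem_left c b hbJ)
    have h2 : π (c * b) = 0 := (TwoSidedIdeal.mem_ker π).1 this
    rw [map_mul] at h2
    exact LinearMap.congr_fun h2 x
  rcases hπ.eq_bot_or_eq_top W hW with h0 | h1
  · rw [h0] at hbx
    exact hx ((Submodule.mem_bot ℂ).1 hbx)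
  · apply hI
    intro c hc
    refine (TwoSidedIdeal.mem_ker π).2 (LinearMap.ext fun y => ?_)
    exact (memW y).1 (h1 ▸ Submodule.mem_top) c hc

/-- The hull-kernel topology: a set `S` is closed if and only if `hull (kernel S) ⊆ S`. -/
instance : TopologicalSpace (StructureSpace A) :=
  TopologicalSpace.ofClosed {S | hull (kernel S) ⊆ S}
    (by
      rintro ⟨P, E, _, _, π, hπ, rfl⟩ hP
      obtain ⟨a, x, hax⟩ := hπ.nonzero
      have h1 : a ∈ TwoSidedIdeal.ker π := hP (mem_kernel.2 fun Q hQ => hQ.elim)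
      exact hax (LinearMap.congr_fun ((TwoSidedIdeal.mem_ker π).1 h1) x))
    (fun 𝒮 h𝒮 P hP S hS => h𝒮 hS (le_trans (kernel_anti (Set.sInter_subset_of_mem hS)) hP))
    (fun S hS T hT P hP => by
      rcases le_or_le_of_inf_le (I := kernel S) (J := kernel T) P
        (fun a h1 h2 => hP (mem_kernel.2 fun Q hQ =>
          hQ.elim (mem_kernel.1 h1 Q) (mem_kernel.1 h2 Q))) with h | h
      · exact Or.inl (hS h)
      · exact Or.inr (hT h))

theorem isClosed_iff {S : Set (StructureSpace A)} : IsClosed S ↔ hull (kernel S) ⊆ S := by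
  rw [← isOpen_compl_iff]
  change hull (kernel Sᶜᶜ) ⊆ Sᶜᶜ ↔ _
  rw [compl_compl]

/-- The closure of `S` in the hull-kernel topology is the hull of the kernel of `S`. -/
theorem closure_eq (S : Set (StructureSpace A)) : closure S = hull (kernel S) := by
  apply Set.Subset.antisymm
  · refine closure_minimal (subset_hull_kernel S) (isClosed_iff.2 fun P hP a ha => ?_)
    exact hP (mem_kernel.2 fun Q hQ => hQ ha)
  · exact fun P hP => isClosed_iff.1 isClosed_closure (le_trans (kernel_anti subset_closure) hP)

end StructureSpace

end StructureSpace

/-! ### The Banach algebra `ℓ¹(Σ)` of a topological dynamical system `Σ = (X, σ)` -/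

noncomputable section EllOne

variable {X : Type u} [TopologicalSpace X]

/-- The `n`-th power of the automorphism `α(f) = f ∘ σ⁻¹` of `C(X)`: `αⁿ(f) = f ∘ σ⁻ⁿ`. -/
def alphaPow (σ : X ≃ₜ X) (n : ℤ) : C(X, ℂ) →ₐ[ℂ] C(X, ℂ) :=
  ContinuousMap.compRightAlgHom ℂ ℂ ((σ ^ (-n) : X ≃ₜ X) : C(X, X))

theorem alphaPow_apply (σ : X ≃ₜ X) (n : ℤ) (f : C(X, ℂ)) (x : X) :
    alphaPow σ n f x = f ((σ ^ (-n) : X ≃ₜ X) x) := rfl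

theorem alphaPow_zero (σ : X ≃ₜ X) (f : C(X, ℂ)) : alphaPow σ 0 f = f := by
  ext x
  rw [alphaPow_apply, neg_zero, zpow_zero]
  rfl

theorem alphaPow_add (σ : X ≃ₜ X) (m n : ℤ) (f : C(X, ℂ)) :
    alphaPow σ (m + n) f = alphaPow σ m (alphaPow σ n f) := by
  ext x
  rw [alphaPow_apply, alphaPow_apply, alphaPow_apply, neg_add_rev, zpow_add]
  rfl

variable [CompactSpace X]

theorem norm_alphaPow_le (σ : X ≃ₜ X) (n : ℤ) (f : C(X, ℂ)) : ‖alphaPow σ n f‖ ≤ ‖f‖ :=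
  (ContinuousMap.norm_le _ (norm_nonneg f)).2 fun _ => f.norm_coe_le_norm _

/-- `αⁿ` as a continuous linear map. -/
def alphaPowL (σ : X ≃ₜ X) (n : ℤ) : C(X, ℂ) →L[ℂ] C(X, ℂ) :=
  (alphaPow σ n).toLinearMap.mkContinuous 1 fun f => by
    simpa using norm_alphaPow_le σ n f

/-- The underlying Banach space `ℓ¹(ℤ, C(X))` of `ℓ¹(Σ)`, `Σ = (X, σ)`, where `C(X)` has the
supremum norm; the multiplication is the twisted convolution defined below. -/
def EllOne (_σ : X ≃ₜ X) : Type u := lp (fun _ : ℤ => C(X, ℂ)) 1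

namespace EllOne

variable {σ : X ≃ₜ X}

instance : NormedAddCommGroup (EllOne σ) :=
  inferInstanceAs (NormedAddCommGroup (lp (fun _ : ℤ => C(X, ℂ)) 1))

instance : NormedSpace ℂ (EllOne σ) :=
  inferInstanceAs (NormedSpace ℂ (lp (fun _ : ℤ => C(X, ℂ)) 1))

instance : CompleteSpace (EllOne σ) :=
  inferInstanceAs (CompleteSpace (lp (fun _ : ℤ => C(X, ℂ)) 1))

instance : CoeFun (EllOne σ) fun _ => ℤ → C(X, ℂ) := ⟨fun a => a.1⟩

@[ext]
theorem ext {a b : EllOne σ} (h : ∀ n, a n = b n) : a = b := Subtype.ext (funext h)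

theorem add_apply (a b : EllOne σ) (n : ℤ) : (a + b) n = a n + b n := rfl

theorem smul_apply (c : ℂ) (a : EllOne σ) (n : ℤ) : (c • a) n = c • a n := rfl

theorem zero_apply (n : ℤ) : (0 : EllOne σ) n = 0 := rfl

theorem hasSum_norm (a : EllOne σ) : HasSum (fun n => ‖a n‖) ‖a‖ := by
  have h := lp.hasSum_norm (p := 1) (by simp) (show lp (fun _ : ℤ => C(X, ℂ)) 1 from a)
  simp only [ENNReal.toReal_one, Real.rpow_one] at h
  exact h

theorem norm_eq_tsum (a : EllOne σ) : ‖a‖ = ∑' n, ‖a n‖ := a.hasSum_norm.tsum_eq.symm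

/-- The terms of the twisted convolution. -/
def convTerm (a b : EllOne σ) (n k : ℤ) : C(X, ℂ) := a k * alphaPow σ k (b (n - k))

theorem norm_convTerm_le (a b : EllOne σ) (n k : ℤ) :
    ‖convTerm a b n k‖ ≤ ‖a k‖ * ‖b (n - k)‖ :=
  (norm_mul_le _ _).trans (by gcongr; exact norm_alphaPow_le _ _ _)

theorem summable_norm_mul_norm (a b : EllOne σ) :
    Summable fun q : ℤ × ℤ => ‖a q.1‖ * ‖b q.2‖ :=
  (EllOne.hasSum_norm a).summable.mul_of_nonneg (EllOne.hasSum_norm b).summable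
    (fun _ => norm_nonneg _) (fun _ => norm_nonneg _)

theorem hasSum_majorant (a b : EllOne σ) :
    HasSum (fun q : ℤ × ℤ => ‖a q.2‖ * ‖b (q.1 - q.2)‖) (‖a‖ * ‖b‖) := by
  have h := (EllOne.hasSum_norm a).mul (EllOne.hasSum_norm b) (summable_norm_mul_norm a b)
  let e : ℤ × ℤ ≃ ℤ × ℤ :=
    { toFun := fun q => (q.2, q.1 - q.2)
      invFun := fun q => (q.1 + q.2, q.1)
      left_inv := fun q => by simp
      right_inv := fun q => by simp }
  exact (e.hasSum_iff).2 h

theorem summable_norm_convTerm (a b : EllOne σ) :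
    Summable fun q : ℤ × ℤ => ‖convTerm a b q.1 q.2‖ :=
  Summable.of_nonneg_of_le (fun _ => norm_nonneg _) (fun q => norm_convTerm_le a b q.1 q.2)
    (hasSum_majorant a b).summable

theorem summable_convTerm (a b : EllOne σ) (n : ℤ) : Summable (convTerm a b n) :=
  Summable.of_norm ((summable_norm_convTerm a b).prod_factor n)

theorem norm_tsum_convTerm_le (a b : EllOne σ) (n : ℤ) :
    ‖∑' k, convTerm a b n k‖ ≤ ∑' k, ‖convTerm a b n k‖ :=
  norm_tsum_le_tsum_norm ((summable_norm_convTerm a b).prod_factor n)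

theorem summable_norm_conv (a b : EllOne σ) : Summable fun n => ‖∑' k, convTerm a b n k‖ :=
  Summable.of_nonneg_of_le (fun _ => norm_nonneg _) (norm_tsum_convTerm_le a b)
    (summable_norm_convTerm a b).prod

/-- Twisted convolution: `(ab)(n) = ∑ₖ a(k) · αᵏ(b(n - k))`. -/
instance : Mul (EllOne σ) where
  mul a b := ⟨fun n => ∑' k, a k * alphaPow σ k (b (n - k)),
    memℓp_gen (by simpa [convTerm] using summable_norm_conv a b)⟩

theorem mul_apply (a b : EllOne σ) (n : ℤ) :
    (a * b) n = ∑' k, a k * alphaPow σ k (b (n - k)) := rfl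

theorem hasSum_mul (a b : EllOne σ) (n : ℤ) :
    HasSum (fun k => a k * alphaPow σ k (b (n - k))) ((a * b) n) :=
  (summable_convTerm a b n).hasSum

/-- The unit: the function `ℤ → C(X)` that is `1` at `0` and `0` elsewhere. -/
instance : One (EllOne σ) where
  one := ⟨fun n => if n = 0 then 1 else 0,
    memℓp_gen (summable_of_ne_finset_zero (s := {0}) fun n hn => by
      rw [Finset.mem_singleton] at hn
      simp [hn])⟩

theorem one_apply (n : ℤ) : (1 : EllOne σ) n = if n = 0 then 1 else 0 := rfl

protected theorem norm_mul_le (a b : EllOne σ) : ‖a * b‖ ≤ ‖a‖ * ‖b‖ := by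
  rw [norm_eq_tsum, ← (hasSum_majorant a b).tsum_eq,
    (hasSum_majorant a b).summable.tsum_prod]
  refine (a * b).hasSum_norm.summable.tsum_le_tsum (fun n => ?_)
    (hasSum_majorant a b).summable.prod
  exact (norm_tsum_convTerm_le a b n).trans
    (((summable_norm_convTerm a b).prod_factor n).tsum_le_tsum (fun k => norm_convTerm_le a b n k)
      ((hasSum_majorant a b).summable.prod_factor n))

protected theorem one_mul (a : EllOne σ) : 1 * a = a := by
  ext1 n
  rw [mul_apply, tsum_eq_single 0]
  · rw [one_apply, if_pos rfl, alphaPow_zero, one_mul, sub_zero]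
  · intro k hk
    simp [one_apply, hk]

protected theorem mul_one (a : EllOne σ) : a * 1 = a := by
  ext1 n
  rw [mul_apply, tsum_eq_single n]
  · simp [one_apply]
  · intro k hk
    simp [one_apply, sub_eq_zero, Ne.symm hk]

protected theorem mul_assoc (a b c : EllOne σ) : a * b * c = a * (b * c) := by
  ext1 n
  let F : ℤ × ℤ → C(X, ℂ) := fun q =>
    a q.1 * alphaPow σ q.1 (b q.2) * alphaPow σ (q.1 + q.2) (c (n - q.1 - q.2))
  have hF : Summable F := by
    refine Summable.of_norm_bounded
      ((summable_norm_mul_norm a b).mul_right ‖c‖) fun q => ?_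
    refine (norm_mul_le _ _).trans (mul_le_mul ((norm_mul_le _ _).trans ?_) ?_
      (norm_nonneg _) (by positivity))
    · gcongr
      exact norm_alphaPow_le _ _ _
    · exact (norm_alphaPow_le _ _ _).trans
        (le_hasSum c.hasSum_norm _ fun _ _ => norm_nonneg _)
  have h1 : (a * (b * c)) n = ∑' q, F q := by
    rw [hF.tsum_prod, mul_apply]
    refine tsum_congr fun j => ?_
    have h := ((hasSum_mul b c (n - j)).mapL (alphaPowL σ j)).mul_left (a j)
    refine h.tsum_eq.symm.trans (tsum_congr fun l => ?_)
    change a j * alphaPow σ j (b l * alphaPow σ l (c (n - j - l))) = _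
    rw [map_mul, ← alphaPow_add, ← mul_assoc]
  have h2 : (a * b * c) n = ∑' q, F q := by
    let e : ℤ × ℤ ≃ ℤ × ℤ :=
      { toFun := fun q => (q.2, q.1 - q.2)
        invFun := fun q => (q.1 + q.2, q.1)
        left_inv := fun q => by simp
        right_inv := fun q => by simp }
    have hFe : Summable (F ∘ e) := e.summable_iff.2 hF
    rw [← e.tsum_eq F, mul_apply]
    refine Eq.trans ?_ (hFe.tsum_prod).symm
    refine tsum_congr fun k => ?_
    have h := (hasSum_mul a b k).mul_right (alphaPow σ k (c (n - k)))
    refine h.tsum_eq.symm.trans (tsum_congr fun j => ?_)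
    change a j * alphaPow σ j (b (k - j)) * alphaPow σ k (c (n - k)) =
      a j * alphaPow σ j (b (k - j)) * alphaPow σ (j + (k - j)) (c (n - j - (k - j)))
    rw [add_sub_cancel, sub_sub, add_sub_cancel]
  rw [h1, h2]

protected theorem left_distrib (a b c : EllOne σ) : a * (b + c) = a * b + a * c := by
  ext1 n
  have h := (hasSum_mul a b n).add (hasSum_mul a c n)
  rw [add_apply, ← h.tsum_eq, mul_apply]
  exact tsum_congr fun k => by rw [add_apply, map_add, mul_add]

protected theorem right_distrib (a b c : EllOne σ) : (a + b) * c = a * c + b * c := by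
  ext1 n
  have h := (hasSum_mul a c n).add (hasSum_mul b c n)
  rw [add_apply, ← h.tsum_eq, mul_apply]
  exact tsum_congr fun k => by rw [add_apply, add_mul]

protected theorem smul_mul (r : ℂ) (a b : EllOne σ) : r • a * b = r • (a * b) := by
  ext1 n
  have h := (hasSum_mul a b n).const_smul r
  rw [smul_apply, ← h.tsum_eq, mul_apply]
  exact tsum_congr fun k => by rw [smul_apply, smul_mul_assoc]

protected theorem mul_smul (r : ℂ) (a b : EllOne σ) : a * r • b = r • (a * b) := by
  ext1 n
  have h := (hasSum_mul a b n).const_smul r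
  rw [smul_apply, ← h.tsum_eq, mul_apply]
  exact tsum_congr fun k => by rw [smul_apply, map_smul, mul_smul_comm]

/-- `ℓ¹(Σ)` is a unital Banach algebra. -/
instance : NormedRing (EllOne σ) where
  __ := (inferInstance : NormedAddCommGroup (EllOne σ))
  left_distrib := EllOne.left_distrib
  right_distrib := EllOne.right_distrib
  zero_mul a := by
    ext1 n
    rw [mul_apply]
    simp [zero_apply]
  mul_zero a := by
    ext1 n
    rw [mul_apply]
    simp [zero_apply]
  mul_assoc := EllOne.mul_assoc
  one_mul := EllOne.one_mul
  mul_one := EllOne.mul_one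
  norm_mul_le := EllOne.norm_mul_le

instance : NormedAlgebra ℂ (EllOne σ) where
  __ := Algebra.ofModule (R := ℂ) (A := EllOne σ) EllOne.smul_mul EllOne.mul_smul
  norm_smul_le := norm_smul_le

end EllOne

/-- The set of orbits `{σⁿ x : n ∈ ℤ}` of a homeomorphism `σ : X → X`. -/
def OrbitSet {X : Type u} [TopologicalSpace X] (σ : X ≃ₜ X) : Type u :=
  {o : Set X // ∃ x : X, o = Set.range fun n : ℤ => (σ ^ n : X ≃ₜ X) x}

end EllOne

/-! ### Irreducible representations built from functionals. -/

section Functional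

variable {A : Type u} [Ring A] [Algebra ℂ A]

/-! For a point `x`, the indicator of `{x}` gives an idempotent `e` of `A = ℓ¹(Σ)`. The iterates of
`σ` fixing `x` are the multiples of some `p ≠ 0`, and the corner `e A e` is a copy of the Wiener
algebra `ℓ¹(ℤ)`: only the numbers `a(pk)(x)` survive in `e a e` (`pointIdem_mul_mul_pointIdem`). The
idempotents of points in one orbit are conjugate, those of distinct orbits do not interact, and all
of them add up to `1`.

Hence an irreducible representation is non-zero on the idempotent of some orbit. There the corner
acts on a vector `e v = v` through a character, which is evaluation at some `z` in the circle. The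
functional `φ_z(a) = ∑ₖ a(pk)(x) zᵏ` then determines the kernel as the set of `a` with `φ_z(b a c) =
0` for all `b`, `c` (`exists_eq_primitiveAt`). Conversely, `φ_z(u e v) = φ_z(u) φ_z(v)`, which makes
the quotient of `A` by the left ideal of `φ_z` irreducible (`quotientRep_irreducible`).

Topologically, `z ↦ φ_z(b a c)` is continuous, so the map from orbits and circle points to primitive
ideals is continuous. It is injective and closed because the Wiener algebra is regular
(`exists_eval_eq_zero_of_isClosed`): autocorrelations of tent functions have summable Fourier
coefficients and small support. -/

/-- The largest left ideal on which a linear functional vanishes. -/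
def leftNullIdeal (φ : A →ₗ[ℂ] ℂ) : Submodule A A where
  carrier := {a | ∀ b, φ (b * a) = 0}
  add_mem' ha hb c := by rw [mul_add, map_add, ha c, hb c, add_zero]
  zero_mem' c := by rw [mul_zero, map_zero]
  smul_mem' r a ha c := by
    rw [smul_eq_mul, ← mul_assoc]
    exact ha _

theorem mem_leftNullIdeal {φ : A →ₗ[ℂ] ℂ} {a : A} :
    a ∈ leftNullIdeal φ ↔ ∀ b, φ (b * a) = 0 := Iff.rfl

/-- The representation of an algebra on its quotient by the left ideal of a functional. -/
def quotientRep (φ : A →ₗ[ℂ] ℂ) : A →ₙₐ[ℂ] Module.End ℂ (A ⧸ leftNullIdeal φ) :=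
  (Algebra.lsmul ℂ ℂ (A ⧸ leftNullIdeal φ) : A →ₐ[ℂ] _)

theorem quotientRep_mk (φ : A →ₗ[ℂ] ℂ) (a b : A) :
    quotientRep φ a (Submodule.Quotient.mk b) = Submodule.Quotient.mk (a * b) := rfl

theorem quotientRep_eq_zero_iff (φ : A →ₗ[ℂ] ℂ) (a : A) :
    quotientRep φ a = 0 ↔ ∀ b c, φ (b * a * c) = 0 := by
  constructor
  · intro h b c
    have h1 := LinearMap.congr_fun h (Submodule.Quotient.mk c)
    rw [quotientRep_mk, LinearMap.zero_apply, Submodule.Quotient.mk_eq_zero] at h1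
    rw [mul_assoc]
    exact h1 b
  · intro h
    refine LinearMap.ext fun y => ?_
    obtain ⟨c, rfl⟩ := Submodule.Quotient.mk_surjective _ y
    rw [quotientRep_mk, LinearMap.zero_apply, Submodule.Quotient.mk_eq_zero]
    intro b
    rw [← mul_assoc]
    exact h b c

/-- The hypothesis on `e` lets any non-zero class be carried back to the class of `1`, which
generates the quotient. -/
theorem quotientRep_irreducible (φ : A →ₗ[ℂ] ℂ) (e : A) (h1 : φ 1 = 1)
    (he : ∀ u v, φ (u * e * v) = φ u * φ v) : IsAlgebraicallyIrreducible (quotientRep φ) where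
  nonzero := by
    refine ⟨1, Submodule.Quotient.mk 1, fun h => ?_⟩
    rw [quotientRep_mk, Submodule.Quotient.mk_eq_zero] at h
    have := h 1
    rw [one_mul, one_mul, h1] at this
    exact one_ne_zero this
  eq_bot_or_eq_top W hW := by
    refine or_iff_not_imp_left.2 fun hbot => ?_
    obtain ⟨w, hw, hw0⟩ := W.ne_bot_iff.1 hbot
    obtain ⟨a, rfl⟩ := Submodule.Quotient.mk_surjective _ w
    rw [Ne, Submodule.Quotient.mk_eq_zero, mem_leftNullIdeal] at hw0
    push Not at hw0
    obtain ⟨b, hb⟩ := hw0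
    have hone : (Submodule.Quotient.mk 1 : A ⧸ leftNullIdeal φ) ∈ W := by
      -- Since `φ (c * e * b * a) = φ c * φ (b * a)` for every `c`, the element `(φ (b * a))⁻¹ • e *
      -- b` sends the class of `a` to that of `1`.
      have h2 := W.smul_mem (φ (b * a))⁻¹ (hW (e * b) _ hw)
      rw [quotientRep_mk, ← Submodule.Quotient.mk_smul] at h2
      convert h2 using 1
      rw [Submodule.Quotient.eq]
      intro c
      rw [mul_sub, map_sub, mul_one, mul_smul_comm, map_smul, ← mul_assoc, ← mul_assoc,
        mul_assoc (c * e), he, smul_eq_mul, mul_left_comm, inv_mul_cancel₀ hb, mul_one, sub_self]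
    refine eq_top_iff.2 fun y _ => ?_
    obtain ⟨c, rfl⟩ := Submodule.Quotient.mk_surjective _ y
    have := hW c _ hone
    rwa [quotientRep_mk, mul_one] at this

/-- The primitive ideal attached to a functional that is multiplicative across an element `e`. -/
def primitiveOfFunctional (φ : A →ₗ[ℂ] ℂ) (e : A) (h1 : φ 1 = 1)
    (he : ∀ u v, φ (u * e * v) = φ u * φ v) : StructureSpace A :=
  ⟨TwoSidedIdeal.ker (quotientRep φ), _, _, _, _, quotientRep_irreducible φ e h1 he, rfl⟩

theorem mem_primitiveOfFunctional {φ : A →ₗ[ℂ] ℂ} {e : A} {h1 : φ 1 = 1}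
    {he : ∀ u v, φ (u * e * v) = φ u * φ v} {a : A} :
    a ∈ (primitiveOfFunctional φ e h1 he).1 ↔ ∀ b c, φ (b * a * c) = 0 :=
  (TwoSidedIdeal.mem_ker _).trans (quotientRep_eq_zero_iff φ a)

end Functional

/-! ### Cyclic vectors and kernels of irreducible representations. -/

section Irreducible

variable {A : Type*} [Ring A] [Algebra ℂ A] {E : Type*} [AddCommGroup E] [Module ℂ E]
  {π : A →ₙₐ[ℂ] Module.End ℂ E}

/-- In an algebraically irreducible representation every non-zero vector is cyclic. -/
theorem IsAlgebraicallyIrreducible.exists_apply_eq (hπ : IsAlgebraicallyIrreducible π) {v : E}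
    (hv : v ≠ 0) (w : E) : ∃ a, π a v = w := by
  let ev : A →ₗ[ℂ] E := (LinearMap.applyₗ v).comp (π : A →ₗ[ℂ] Module.End ℂ E)
  have hev : ∀ a, ev a = π a v := fun _ => rfl
  rcases hπ.eq_bot_or_eq_top (LinearMap.range ev) (by
    rintro a _ ⟨b, rfl⟩
    exact ⟨a * b, by rw [hev, hev, map_mul]; rfl⟩) with h | h
  · exfalso
    have h0 : ∀ a, π a v = 0 := fun a => by
      have : ev a ∈ LinearMap.range ev := ⟨a, rfl⟩
      rwa [h, Submodule.mem_bot] at this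
    -- If `v` is annihilated by everything, its line is invariant, hence all of `E`, and the
    -- representation vanishes.
    rcases hπ.eq_bot_or_eq_top (ℂ ∙ v) (by
      intro a y hy
      obtain ⟨c, rfl⟩ := Submodule.mem_span_singleton.1 hy
      rw [map_smul, h0, smul_zero]
      exact zero_mem _) with h2 | h2
    · exact hv (Submodule.span_singleton_eq_bot.1 h2)
    · obtain ⟨a, y, hay⟩ := hπ.nonzero
      obtain ⟨c, rfl⟩ := Submodule.mem_span_singleton.1 (h2 ▸ Submodule.mem_top : y ∈ ℂ ∙ v)
      rw [map_smul, h0, smul_zero] at hay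
      exact hay rfl
  · exact LinearMap.mem_range.1 (h ▸ Submodule.mem_top : w ∈ LinearMap.range ev)

theorem IsAlgebraicallyIrreducible.map_one (hπ : IsAlgebraicallyIrreducible π) : π 1 = 1 := by
  obtain ⟨a, x, hax⟩ := hπ.nonzero
  refine LinearMap.ext fun w => ?_
  obtain ⟨b, rfl⟩ := hπ.exists_apply_eq hax w
  rw [← Module.End.mul_apply, ← map_mul, one_mul, Module.End.one_apply]

/-- If `e` compresses the algebra to scalars `φ` on a non-zero vector, the kernel of the
representation is determined by `φ`. -/
theorem IsAlgebraicallyIrreducible.map_eq_zero_iff (hπ : IsAlgebraicallyIrreducible π)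
    {φ : A → ℂ} {e : A} {v : E} (hv : v ≠ 0) (hev : π e v = v)
    (h : ∀ a, π (e * a * e) v = φ a • v) (a : A) :
    π a = 0 ↔ ∀ b c, φ (b * a * c) = 0 := by
  constructor
  · intro ha b c
    have h1 := h (b * a * c)
    simp only [map_mul, ha, mul_zero, zero_mul, LinearMap.zero_apply] at h1
    exact (smul_eq_zero.1 h1.symm).resolve_right hv
  · intro h0
    refine LinearMap.ext fun y => ?_
    obtain ⟨c, rfl⟩ := hπ.exists_apply_eq hv y
    by_contra hne
    obtain ⟨b, hb⟩ := hπ.exists_apply_eq hne v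
    have h1 := h (b * a * c)
    simp only [map_mul, Module.End.mul_apply, hev, hb, h0, zero_smul] at h1
    exact hv h1

end Irreducible

noncomputable section

/-! ### Monomials and coefficients in `ℓ¹(Σ)`. -/

namespace EllOne

section Basic

variable {X : Type u} [TopologicalSpace X] [CompactSpace X] {σ : X ≃ₜ X}

/-- An absolutely summable family as an element of `ℓ¹(Σ)`. -/
def ofSummable (f : ℤ → C(X, ℂ)) (hf : Summable fun n => ‖f n‖) : EllOne σ :=
  ⟨f, memℓp_gen (by simpa using hf)⟩

theorem ofSummable_apply (f : ℤ → C(X, ℂ)) (hf : Summable fun n => ‖f n‖) (n : ℤ) :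
    (ofSummable f hf : EllOne σ) n = f n := rfl

/-- The element `f δⁿ` of `ℓ¹(Σ)`. -/
def single (n : ℤ) (f : C(X, ℂ)) : EllOne σ := lp.single (E := fun _ : ℤ => C(X, ℂ)) 1 n f

theorem single_apply (n : ℤ) (f : C(X, ℂ)) (m : ℤ) :
    (single n f : EllOne σ) m = if m = n then f else 0 := by
  change Pi.single (M := fun _ : ℤ => C(X, ℂ)) n f m = _
  rw [Pi.single_apply]

theorem single_apply_self (n : ℤ) (f : C(X, ℂ)) : (single n f : EllOne σ) n = f := by
  rw [single_apply, if_pos rfl]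

theorem single_apply_ne {n m : ℤ} (h : m ≠ n) (f : C(X, ℂ)) :
    (single n f : EllOne σ) m = 0 := by
  rw [single_apply, if_neg h]

theorem one_eq_single : (1 : EllOne σ) = single 0 1 := by
  ext1 n
  rw [one_apply, single_apply]

theorem norm_single (n : ℤ) (f : C(X, ℂ)) : ‖(single n f : EllOne σ)‖ = ‖f‖ :=
  lp.norm_single (p := 1) (E := fun _ : ℤ => C(X, ℂ)) (by simp) n f

theorem hasSum_single (a : EllOne σ) : HasSum (fun n => (single n (a n) : EllOne σ)) a :=
  lp.hasSum_single (p := 1) (E := fun _ : ℤ => C(X, ℂ)) (by simp) a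

theorem mul_single_apply (a : EllOne σ) (m : ℤ) (g : C(X, ℂ)) (n : ℤ) :
    (a * single m g : EllOne σ) n = a (n - m) * alphaPow σ (n - m) g := by
  rw [mul_apply, tsum_eq_single (n - m), sub_sub_cancel, single_apply_self]
  intro k hk
  rw [single_apply_ne, map_zero, mul_zero]
  omega

theorem single_mul_apply (m : ℤ) (f : C(X, ℂ)) (a : EllOne σ) (n : ℤ) :
    (single m f * a : EllOne σ) n = f * alphaPow σ m (a (n - m)) := by
  rw [mul_apply, tsum_eq_single m, single_apply_self]
  intro k hk
  rw [single_apply_ne hk, zero_mul]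

theorem single_mul_single (m : ℤ) (f : C(X, ℂ)) (n : ℤ) (g : C(X, ℂ)) :
    (single m f * single n g : EllOne σ) = single (m + n) (f * alphaPow σ m g) := by
  ext1 k
  rw [single_mul_apply, single_apply, single_apply, apply_ite (alphaPow σ m), map_zero,
    mul_ite, mul_zero]
  congr 1
  rw [eq_iff_iff]
  omega

theorem hasSum_mul_apply (a b : EllOne σ) (n : ℤ) (x : X) :
    HasSum (fun k => a k x * b (n - k) ((σ ^ (-k) : X ≃ₜ X) x)) ((a * b) n x) :=
  (hasSum_mul a b n).mapL (ContinuousMap.evalCLM ℂ x)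

theorem summable_norm_apply (a : EllOne σ) (x : X) : Summable fun n => ‖a n x‖ :=
  Summable.of_nonneg_of_le (fun _ => norm_nonneg _) (fun n => (a n).norm_coe_le_norm x)
    a.hasSum_norm.summable

end Basic

end EllOne

/-! ### The Wiener algebra -/

/-- The Wiener algebra `ℓ¹(ℤ)`, as the algebra of the one-point dynamical system. -/
abbrev WienerAlgebra : Type := EllOne (Homeomorph.refl Unit)

namespace WienerAlgebra

open EllOne

theorem ext' {f g : WienerAlgebra} (h : ∀ n, f n () = g n ()) : f = g :=
  EllOne.ext fun n => ContinuousMap.ext fun _ => h n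

theorem hasSum_mul_coeff (f g : WienerAlgebra) (n : ℤ) :
    HasSum (fun k => f k () * g (n - k) ()) ((f * g) n ()) :=
  hasSum_mul_apply f g n ()

instance : NormedCommRing WienerAlgebra where
  __ := (inferInstance : NormedRing WienerAlgebra)
  mul_comm f g := by
    refine ext' fun n => ?_
    rw [← (hasSum_mul_coeff f g n).tsum_eq, ← (hasSum_mul_coeff g f n).tsum_eq,
      ← (Equiv.subLeft n).tsum_eq]
    refine tsum_congr fun k => ?_
    rw [Equiv.subLeft_apply, sub_sub_cancel, mul_comm]

/-- An element of the Wiener algebra from its coefficients. -/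
def mk (c : ℤ → ℂ) (hc : Summable fun n => ‖c n‖) : WienerAlgebra :=
  ofSummable (fun n => ContinuousMap.const Unit (c n))
    (hc.congr fun n => le_antisymm ((ContinuousMap.const Unit (c n)).norm_coe_le_norm ())
      ((ContinuousMap.norm_le _ (norm_nonneg _)).2 fun _ => le_rfl))

theorem mk_apply (c : ℤ → ℂ) (hc : Summable fun n => ‖c n‖) (n : ℤ) : mk c hc n () = c n := rfl

theorem one_coeff (n : ℤ) : (1 : WienerAlgebra) n () = if n = 0 then 1 else 0 := by
  rw [one_apply]
  split_ifs <;> rfl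

theorem summable_norm_coeff_mul (f : WienerAlgebra) (z : Circle) :
    Summable fun n => ‖f n () * (z : ℂ) ^ n‖ := by
  refine (summable_norm_apply f ()).congr fun n => ?_
  rw [norm_mul, norm_zpow, Circle.norm_coe, one_zpow, mul_one]

/-- The value at `z` of the absolutely convergent Fourier series `f`. -/
def eval (z : Circle) : WienerAlgebra →ₗ[ℂ] ℂ where
  toFun f := ∑' n, f n () * (z : ℂ) ^ n
  map_add' f g := by
    rw [← (summable_norm_coeff_mul f z).of_norm.tsum_add (summable_norm_coeff_mul g z).of_norm]
    exact tsum_congr fun n => by rw [EllOne.add_apply, ContinuousMap.add_apply, add_mul]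
  map_smul' c f := by
    rw [RingHom.id_apply, smul_eq_mul, ← tsum_mul_left]
    exact tsum_congr fun n => by
      rw [EllOne.smul_apply, ContinuousMap.smul_apply, smul_eq_mul, mul_assoc]

theorem eval_apply (z : Circle) (f : WienerAlgebra) :
    eval z f = ∑' n, f n () * (z : ℂ) ^ n := rfl

theorem eval_one (z : Circle) : eval z 1 = 1 := by
  rw [eval_apply, tsum_eq_single 0]
  · simp [one_coeff]
  · intro n hn
    simp [one_coeff, hn]

theorem eval_mul (z : Circle) (f g : WienerAlgebra) : eval z (f * g) = eval z f * eval z g := by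
  have hf := summable_norm_coeff_mul f z
  have hg := summable_norm_coeff_mul g z
  rw [eval_apply, eval_apply, eval_apply, tsum_mul_tsum_of_summable_norm hf hg]
  -- Reindexes the double series by total degree: `(n, k)` stands for the pair of exponents `(k, n -
  -- k)`.
  let e : ℤ × ℤ ≃ ℤ × ℤ :=
    { toFun := fun q => (q.2, q.1 - q.2)
      invFun := fun q => (q.1 + q.2, q.1)
      left_inv := fun q => by simp
      right_inv := fun q => by simp }
  have hs := (summable_mul_of_summable_norm hf hg)
  have hse := e.summable_iff.2 hs
  rw [← e.tsum_eq]
  refine Eq.trans ?_ hse.tsum_prod.symm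
  refine tsum_congr fun n => ?_
  rw [← ((hasSum_mul_coeff f g n).mul_right ((z : ℂ) ^ n)).tsum_eq]
  refine tsum_congr fun k => ?_
  change _ = f k () * (z : ℂ) ^ k * (g (n - k) () * (z : ℂ) ^ (n - k))
  rw [mul_mul_mul_comm, ← zpow_add₀ z.coe_ne_zero, add_sub_cancel]

theorem continuous_eval (f : WienerAlgebra) : Continuous fun z => eval z f := by
  refine continuous_tsum (u := fun n => ‖f n ()‖) (fun n => ?_) (summable_norm_apply f ())
    fun n z => by rw [norm_mul, norm_zpow, Circle.norm_coe, one_zpow, mul_one]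
  have h : Continuous fun z : Circle => ((z ^ n : Circle) : ℂ) :=
    continuous_induced_dom.comp (continuous_zpow n)
  simp only [Circle.coe_zpow] at h
  exact continuous_const.mul h

theorem single_mul_single_coeff (m n : ℤ) (c d : C(Unit, ℂ)) :
    (single m c * single n d : WienerAlgebra) = single (m + n) (c * d) := by
  rw [single_mul_single]
  congr 1

/-- Every character of the Wiener algebra is the evaluation at a point of the circle. -/
theorem exists_eq_eval (χ : WeakDual.characterSpace ℂ WienerAlgebra) :
    ∃ z : Circle, ∀ f, χ f = eval z f := by
  have hinv : ∀ n : ℤ, χ (single n 1) * χ (single (-n) 1) = 1 := fun n => by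
    rw [← map_mul, single_mul_single_coeff, add_neg_cancel, mul_one, ← one_eq_single, map_one]
  have hnorm : ∀ n : ℤ, ‖χ (single n 1)‖ ≤ 1 := fun n => by
    have h1 := spectrum.norm_le_norm_mul_of_mem (AlgHom.apply_mem_spectrum χ (single n 1))
    rw [one_eq_single, norm_single, norm_single] at h1
    simpa using h1
  -- The values at `δ` and `δ⁻¹` both have modulus at most `1`, and their product is `1`.
  have hz : ‖χ (single 1 1)‖ = 1 := by
    refine le_antisymm (hnorm 1) ?_
    have h1 := congrArg norm (hinv 1)
    rw [norm_mul, norm_one] at h1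
    nlinarith [hnorm (-1), hnorm 1, norm_nonneg (χ (single 1 1))]
  let z : Circle := ⟨χ (single 1 1), mem_sphere_zero_iff_norm.2 hz⟩
  have hnat : ∀ n : ℕ, χ (single (n : ℤ) 1) = (z : ℂ) ^ n := fun n => by
    induction n with
    | zero => rw [Nat.cast_zero, ← one_eq_single, map_one, pow_zero]
    | succ n ih =>
      rw [pow_succ, ← ih, Nat.cast_succ, ← mul_one (1 : C(Unit, ℂ)), ← single_mul_single_coeff,
        map_mul, mul_one]
  have hint : ∀ n : ℤ, χ (single n 1) = (z : ℂ) ^ n := fun n => by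
    obtain ⟨n, rfl | rfl⟩ := n.eq_nat_or_neg
    · rw [hnat, zpow_natCast]
    · rw [zpow_neg, zpow_natCast, ← hnat]
      exact eq_inv_of_mul_eq_one_right (hinv n)
  refine ⟨z, fun f => ?_⟩
  -- By continuity, `χ` is determined by its values on the monomials.
  have h := (EllOne.hasSum_single f).map χ (map_continuous χ)
  rw [← h.tsum_eq, eval_apply]
  refine tsum_congr fun n => ?_
  have hs : (single n (f n) : WienerAlgebra) = f n () • single n 1 := by
    refine ext' fun m => ?_
    rw [EllOne.smul_apply, single_apply, single_apply]
    split_ifs <;> simp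
  rw [Function.comp_apply, hs, map_smul, hint, smul_eq_mul]

end WienerAlgebra


/-! ### Regularity of the Wiener algebra -/

section Regularity

open MeasureTheory ComplexConjugate

/-- Invariance of Haar measure under translation, together with multiplicativity of the
exponentials. -/
theorem fourierCoeff_comp_add_right {T : ℝ} [Fact (0 < T)] (h : AddCircle T → ℂ)
    (t : AddCircle T) (n : ℤ) :
    fourierCoeff (fun s => h (s + t)) n = fourier n t * fourierCoeff h n := by
  rw [fourierCoeff, fourierCoeff, ← integral_const_mul,
    ← integral_add_right_eq_self (fun s => fourier n t * fourier (-n) s • h s) t]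
  refine integral_congr_ae (Filter.Eventually.of_forall fun s => ?_)
  have h1 : fourier n t * (fourier (-n) (s + t) : ℂ) = fourier (-n) s := by
    simp only [fourier_apply, neg_smul, smul_add, AddCircle.toCircle_add,
      AddCircle.toCircle_neg, Circle.coe_mul, Circle.coe_inv]
    field_simp
  change fourier (-n) s • h (s + t) = fourier n t * (fourier (-n) (s + t) • h (s + t))
  rw [smul_eq_mul, smul_eq_mul, ← mul_assoc, h1]

/-- Parseval's formula for the autocorrelation of a continuous function on the circle. -/
theorem hasSum_norm_sq_fourierCoeff_mul {T : ℝ} [Fact (0 < T)] (h : C(AddCircle T, ℂ))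
    (t : AddCircle T) :
    HasSum (fun n => ((‖fourierCoeff h n‖ ^ 2 : ℝ) : ℂ) * fourier n t)
      (∫ s, h (s + t) * conj (h s) ∂AddCircle.haarAddCircle) := by
  let ht : C(AddCircle T, ℂ) := ⟨fun s => h (s + t), by fun_prop⟩
  let H := ContinuousMap.toLp (E := ℂ) 2 AddCircle.haarAddCircle ℂ h
  let Ht := ContinuousMap.toLp (E := ℂ) 2 AddCircle.haarAddCircle ℂ ht
  have hs := fourierBasis.hasSum_inner_mul_inner H Ht
  -- The coefficients of `h` and of its translate differ by a phase, so their product is a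
  -- non-negative number times that phase.
  have key : ∀ n, inner ℂ H (fourierBasis n) * inner ℂ (fourierBasis n) Ht =
      ((‖fourierCoeff h n‖ ^ 2 : ℝ) : ℂ) * fourier n t := fun n => by
    rw [← inner_conj_symm, ← HilbertBasis.repr_apply_apply, ← HilbertBasis.repr_apply_apply,
      fourierBasis_repr, fourierBasis_repr, fourierCoeff_toLp, fourierCoeff_toLp]
    change _ * fourierCoeff (fun s => h (s + t)) n = _
    rw [fourierCoeff_comp_add_right, mul_left_comm, Complex.conj_mul', mul_comm,
      Complex.ofReal_pow]
  rw [funext key, ContinuousMap.inner_toLp] at hs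
  exact hs

/-- The tent function of radius `r` around `0` on the circle. -/
def tent (r : ℝ) : C(UnitAddCircle, ℂ) where
  toFun s := ((max 0 (r - ‖s‖) : ℝ) : ℂ)
  continuous_toFun := by fun_prop

theorem tent_apply (r : ℝ) (s : UnitAddCircle) :
    tent r s = ((max 0 (r - ‖s‖) : ℝ) : ℂ) := rfl

theorem tent_eq_zero {r : ℝ} {s : UnitAddCircle} (h : r ≤ ‖s‖) : tent r s = 0 := by
  rw [tent_apply, max_eq_left (by linarith), Complex.ofReal_zero]

/-- The tent and its translate by at least twice the radius are nowhere both non-zero. -/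
theorem integral_tent_shift_eq_zero {r : ℝ} {t : UnitAddCircle} (ht : 2 * r ≤ ‖t‖) :
    ∫ s, tent r (s + t) * conj (tent r s) ∂AddCircle.haarAddCircle = 0 := by
  rw [← integral_zero UnitAddCircle ℂ (μ := AddCircle.haarAddCircle)]
  congr 1
  funext s
  by_cases hs : r ≤ ‖s‖
  · rw [tent_eq_zero hs, map_zero, mul_zero]
  · have h1 : ‖t‖ ≤ ‖s + t‖ + ‖s‖ := by
      simpa using norm_sub_le (s + t) s
    rw [tent_eq_zero (by linarith), zero_mul]

theorem integral_tent_ne_zero {r : ℝ} (hr : 0 < r) :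
    ∫ s, tent r (s + 0) * conj (tent r s) ∂AddCircle.haarAddCircle ≠ 0 := by
  have h : ∀ s, tent r (s + 0) * conj (tent r s) = ((max 0 (r - ‖s‖) ^ 2 : ℝ) : ℂ) := fun s => by
    rw [add_zero, tent_apply, Complex.conj_ofReal, ← Complex.ofReal_mul, sq]
  simp_rw [h]
  rw [integral_complex_ofReal]
  refine Complex.ofReal_ne_zero.2 (ne_of_gt ?_)
  have hc : Continuous fun s : UnitAddCircle => max 0 (r - ‖s‖) ^ 2 := by fun_prop
  refine hc.integral_pos_of_hasCompactSupport_nonneg_nonzero (x := 0)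
    (HasCompactSupport.of_compactSpace _) (fun s => by positivity) ?_
  rw [norm_zero, sub_zero, max_eq_right hr.le]
  positivity

namespace WienerAlgebra

/-- The Wiener algebra is regular: its elements separate points from closed sets. -/
theorem exists_eval_eq_zero_of_isClosed {S : Set Circle} (hS : IsClosed S) {z : Circle}
    (hz : z ∉ S) : ∃ f : WienerAlgebra, (∀ w ∈ S, eval w f = 0) ∧ eval z f ≠ 0 := by
  let θ := AddCircle.homeomorphCircle (one_ne_zero (α := ℝ))
  have hθ : ∀ t, θ t = AddCircle.toCircle t := AddCircle.homeomorphCircle_apply _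
  have hθ0 : θ 0 = 1 := by rw [hθ, AddCircle.toCircle_zero]
  have hopen : IsOpen {t | z * θ t ∉ S} :=
    hS.isOpen_compl.preimage (continuous_const.mul θ.continuous)
  obtain ⟨ε, hε, hball⟩ := Metric.isOpen_iff.1 hopen 0 (by
    rw [Set.mem_ofPred_eq, hθ0, mul_one]
    exact hz)
  -- Coefficients of the autocorrelation of a tent. The radius `ε / 2` makes it vanish outside the
  -- `ε`-ball; non-negativity turns convergence at `t = 0` into absolute summability.
  let c : ℤ → ℝ := fun n => ‖fourierCoeff (tent (ε / 2)) n‖ ^ 2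
  have hc0 : ∀ n, 0 ≤ c n := fun n => by positivity
  have hsum := hasSum_norm_sq_fourierCoeff_mul (tent (ε / 2))
  have hcs : Summable c := by
    have := (hsum 0).summable
    simp only [fourier_eval_zero, mul_one] at this
    exact Complex.summable_ofReal.1 this
  -- The factor `z⁻ⁿ` rotates the bump from `1` to `z`.
  let f : WienerAlgebra := mk (fun n => (c n : ℂ) * ((z⁻¹ : Circle) : ℂ) ^ n)
    (hcs.congr fun n => by
      rw [norm_mul, norm_zpow, Circle.norm_coe, one_zpow, mul_one, Complex.norm_real,
        Real.norm_of_nonneg (hc0 n)])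
  have hf : ∀ t, eval (z * θ t) f =
      ∫ s, tent (ε / 2) (s + t) * conj (tent (ε / 2) s) ∂AddCircle.haarAddCircle := fun t => by
    rw [eval_apply, ← (hsum t).tsum_eq]
    refine tsum_congr fun n => ?_
    rw [mk_apply, mul_assoc, fourier_apply, AddCircle.toCircle_zsmul, ← hθ, ← Circle.coe_zpow,
      ← Circle.coe_zpow, ← Circle.coe_mul, ← mul_zpow, inv_mul_cancel_left]
  refine ⟨f, fun w hw => ?_, ?_⟩
  · obtain ⟨t, ht⟩ := θ.surjective (z⁻¹ * w)
    have hw' : z * θ t = w := by rw [ht, mul_inv_cancel_left]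
    rw [← hw', hf]
    refine integral_tent_shift_eq_zero (le_of_not_gt fun hlt => ?_)
    refine hball (mem_ball_zero_iff.2 (show ‖t‖ < ε by linarith)) ?_
    rwa [hw']
  · have h0 := hf 0
    rw [hθ0, mul_one] at h0
    rw [h0]
    exact integral_tent_ne_zero (by positivity)

end WienerAlgebra

end Regularity


/-! ### Compression to the isotropy of a point -/

namespace EllOne

section Isotropy

variable {X : Type u} [TopologicalSpace X]

/-- The iterates of `σ` fixing `x` are those whose exponent is a multiple of `p`. -/
def IsPeriod (σ : X ≃ₜ X) (x : X) (p : ℤ) : Prop :=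
  p ≠ 0 ∧ ∀ n : ℤ, (σ ^ n : X ≃ₜ X) x = x ↔ p ∣ n

theorem zpow_add_apply (σ : X ≃ₜ X) (m n : ℤ) (x : X) :
    (σ ^ (m + n) : X ≃ₜ X) x = (σ ^ m : X ≃ₜ X) ((σ ^ n : X ≃ₜ X) x) := by
  rw [zpow_add]
  rfl

theorem zpow_zero_apply (σ : X ≃ₜ X) (x : X) : (σ ^ (0 : ℤ) : X ≃ₜ X) x = x := by
  rw [zpow_zero]
  rfl

theorem zpow_neg_apply_eq_iff (σ : X ≃ₜ X) (n : ℤ) (x y : X) :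
    (σ ^ (-n) : X ≃ₜ X) y = x ↔ y = (σ ^ n : X ≃ₜ X) x := by
  constructor
  · rintro rfl
    rw [← zpow_add_apply, add_neg_cancel, zpow_zero_apply]
  · rintro rfl
    rw [← zpow_add_apply, neg_add_cancel, zpow_zero_apply]

/-- The exponents fixing `x` form a subgroup of `ℤ`, hence a cyclic one; a zero generator would make
the orbit infinite. The sign of `p` is left open. -/
theorem exists_isPeriod [Finite X] (σ : X ≃ₜ X) (x : X) : ∃ p, IsPeriod σ x p := by
  let H : AddSubgroup ℤ :=
    { carrier := {n | (σ ^ n : X ≃ₜ X) x = x}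
      add_mem' := fun {m n} hm hn => by
        rw [Set.mem_ofPred_eq] at hm hn ⊢
        rw [zpow_add_apply, hn, hm]
      zero_mem' := zpow_zero_apply σ x
      neg_mem' := fun {n} hn => by
        rw [Set.mem_ofPred_eq] at hn ⊢
        rw [zpow_neg_apply_eq_iff, hn] }
  obtain ⟨p, hp⟩ := Int.subgroup_cyclic H
  have hmem : ∀ n : ℤ, (σ ^ n : X ≃ₜ X) x = x ↔ p ∣ n := fun n => by
    change n ∈ H ↔ _
    rw [hp, ← AddSubgroup.zmultiples_eq_closure, Int.mem_zmultiples_iff]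
  refine ⟨p, ?_, hmem⟩
  rintro rfl
  refine not_injective_infinite_finite (fun n : ℤ => (σ ^ n : X ≃ₜ X) x) fun m n hmn => ?_
  have h : (σ ^ (-m + n) : X ≃ₜ X) x = x := by
    rw [zpow_add_apply, zpow_neg_apply_eq_iff]
    exact hmn.symm
  rw [hmem, zero_dvd_iff] at h
  omega

open Classical in
/-- The indicator function of a point of a finite discrete space. -/
def indicatorPt [T1Space X] [Finite X] (x : X) : C(X, ℂ) :=
  ⟨fun y => if y = x then 1 else 0, continuous_of_discreteTopology⟩

open Classical in
theorem indicatorPt_apply [T1Space X] [Finite X] (x y : X) : indicatorPt x y = if y = x then 1 else 0 := rfl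

variable [CompactSpace X] {σ : X ≃ₜ X} {x : X} {p : ℤ}

/-- The compression `a ↦ (k ↦ a(pk)(x))` of `ℓ¹(Σ)` to the Wiener algebra. -/
def compress (σ : X ≃ₜ X) (x : X) (hp : IsPeriod σ x p) : EllOne σ →ₗ[ℂ] WienerAlgebra where
  toFun a := WienerAlgebra.mk (fun k => a (p * k) x)
    ((summable_norm_apply a x).comp_injective (mul_right_injective₀ hp.1))
  map_add' _ _ := WienerAlgebra.ext' fun _ => rfl
  map_smul' _ _ := WienerAlgebra.ext' fun _ => rfl

theorem compress_apply (hp : IsPeriod σ x p) (a : EllOne σ) (k : ℤ) :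
    compress σ x hp a k () = a (p * k) x := rfl

theorem compress_one (hp : IsPeriod σ x p) : compress σ x hp 1 = 1 := by
  refine WienerAlgebra.ext' fun k => ?_
  rw [compress_apply, one_apply, WienerAlgebra.one_coeff]
  simp only [mul_eq_zero, hp.1, false_or]
  split_ifs <;> rfl

variable [T1Space X] [Finite X]

/-- The idempotent of `ℓ¹(Σ)` given by the indicator function of a point. -/
def pointIdem (σ : X ≃ₜ X) (x : X) : EllOne σ := single 0 (indicatorPt x)

-- Moving the indicator past `δⁿ` shifts it to `σⁿ x`, whereas multiplication on the left leaves it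
-- at `x`.
open Classical in
theorem mul_pointIdem_apply (a : EllOne σ) (x : X) (n : ℤ) (y : X) :
    (a * pointIdem σ x) n y = if y = (σ ^ n : X ≃ₜ X) x then a n y else 0 := by
  rw [pointIdem, mul_single_apply, sub_zero, ContinuousMap.mul_apply, alphaPow_apply,
    indicatorPt_apply, mul_ite, mul_one, mul_zero]
  exact if_congr (zpow_neg_apply_eq_iff σ n x y) rfl rfl

open Classical in
theorem pointIdem_mul_apply (a : EllOne σ) (x : X) (n : ℤ) (y : X) :
    (pointIdem σ x * a) n y = if y = x then a n y else 0 := by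
  rw [pointIdem, single_mul_apply, sub_zero, ContinuousMap.mul_apply, alphaPow_zero,
    indicatorPt_apply, ite_mul, one_mul, zero_mul]

theorem sum_pointIdem [Fintype X] : ∑ x, pointIdem σ x = 1 := by
  have h : ∀ n y (s : Finset X), (∑ x ∈ s, pointIdem σ x) n y = ∑ x ∈ s, (pointIdem σ x) n y := by
    classical
    intro n y s
    induction s using Finset.induction_on with
    | empty => rfl
    | insert x s hx ih => rw [Finset.sum_insert hx, Finset.sum_insert hx, ← ih]; rfl
  refine EllOne.ext fun n => ContinuousMap.ext fun y => ?_
  rw [h, one_apply]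
  by_cases hn : n = 0
  · subst hn
    rw [if_pos rfl, Finset.sum_eq_single y]
    · rw [pointIdem, single_apply_self, indicatorPt_apply, if_pos rfl, ContinuousMap.one_apply]
    · intro x _ hx
      rw [pointIdem, single_apply_self, indicatorPt_apply, if_neg hx.symm]
    · exact fun hy => (hy (Finset.mem_univ y)).elim
  · simp [pointIdem, single_apply_ne hn, hn]

/-- Conjugacy along an orbit: a representation killing the idempotent of one point kills those of
the whole orbit. -/
theorem pointIdem_zpow (σ : X ≃ₜ X) (x : X) (n : ℤ) :
    pointIdem σ ((σ ^ n : X ≃ₜ X) x) = single n 1 * pointIdem σ x * single (-n) 1 := by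
  rw [pointIdem, pointIdem, single_mul_single, single_mul_single, map_one, mul_one, one_mul,
    add_zero, add_neg_cancel]
  congr 1
  ext y
  rw [alphaPow_apply, indicatorPt_apply, indicatorPt_apply, zpow_neg_apply_eq_iff]

/-- The embedding of the Wiener algebra in `ℓ¹(Σ)` as the corner of a point. -/
def inflate (σ : X ≃ₜ X) (x : X) (hp : IsPeriod σ x p) : WienerAlgebra →ₗ[ℂ] EllOne σ where
  toFun f := ofSummable
    (fun n => Function.extend (fun k => p * k) (fun k => f k ()) 0 n • indicatorPt x) (by
      simp_rw [norm_smul]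
      refine Summable.mul_right _ ?_
      refine ((mul_right_injective₀ hp.1).summable_iff fun n hn => ?_).1
        ((summable_norm_apply f ()).congr fun k => ?_)
      · rw [Function.extend_apply' _ _ _ hn, Pi.zero_apply, norm_zero]
      · rw [Function.comp_apply, (mul_right_injective₀ hp.1).extend_apply])
  map_add' f g := by
    refine EllOne.ext fun n => ?_
    rw [EllOne.add_apply, ofSummable_apply, ofSummable_apply, ofSummable_apply, ← add_smul]
    congr 1
    by_cases hn : ∃ k, p * k = n
    · obtain ⟨k, rfl⟩ := hn
      simp only [(mul_right_injective₀ hp.1).extend_apply]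
      rfl
    · simp [Function.extend_apply' _ _ _ hn]
  map_smul' c f := by
    refine EllOne.ext fun n => ?_
    rw [EllOne.smul_apply, ofSummable_apply, ofSummable_apply, smul_smul, RingHom.id_apply]
    congr 1
    by_cases hn : ∃ k, p * k = n
    · obtain ⟨k, rfl⟩ := hn
      simp only [(mul_right_injective₀ hp.1).extend_apply]
      rfl
    · simp [Function.extend_apply' _ _ _ hn]

theorem inflate_apply_mul (hp : IsPeriod σ x p) (f : WienerAlgebra) (k : ℤ) :
    inflate σ x hp f (p * k) = f k () • indicatorPt x := by
  change Function.extend (fun k => p * k) (fun k => f k ()) 0 (p * k) • indicatorPt x = _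
  rw [(mul_right_injective₀ hp.1).extend_apply]

theorem inflate_apply_of_not_dvd (hp : IsPeriod σ x p) (f : WienerAlgebra) {n : ℤ}
    (hn : ¬ p ∣ n) : inflate σ x hp f n = 0 := by
  change Function.extend (fun k => p * k) (fun k => f k ()) 0 n • indicatorPt x = _
  rw [Function.extend_apply' _ _ _ fun ⟨k, hk⟩ => hn ⟨k, hk.symm⟩, Pi.zero_apply, zero_smul]

theorem inflate_apply_ne (hp : IsPeriod σ x p) (f : WienerAlgebra) (n : ℤ) {y : X} (hy : y ≠ x) :
    inflate σ x hp f n y = 0 := by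
  by_cases hn : p ∣ n
  · obtain ⟨k, rfl⟩ := hn
    rw [inflate_apply_mul, ContinuousMap.smul_apply, indicatorPt_apply, if_neg hy, smul_zero]
  · rw [inflate_apply_of_not_dvd hp f hn, ContinuousMap.zero_apply]

theorem compress_inflate (hp : IsPeriod σ x p) (f : WienerAlgebra) :
    compress σ x hp (inflate σ x hp f) = f := by
  refine WienerAlgebra.ext' fun k => ?_
  rw [compress_apply, inflate_apply_mul, ContinuousMap.smul_apply, indicatorPt_apply,
    if_pos rfl, smul_eq_mul, mul_one]

theorem pointIdem_mul_inflate (hp : IsPeriod σ x p) (f : WienerAlgebra) :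
    pointIdem σ x * inflate σ x hp f = inflate σ x hp f := by
  classical
  refine EllOne.ext fun n => ContinuousMap.ext fun y => ?_
  rw [pointIdem_mul_apply, ite_eq_left_iff]
  exact fun hy => (inflate_apply_ne hp f n hy).symm

theorem inflate_mul_pointIdem (hp : IsPeriod σ x p) (f : WienerAlgebra) :
    inflate σ x hp f * pointIdem σ x = inflate σ x hp f := by
  classical
  refine EllOne.ext fun n => ContinuousMap.ext fun y => ?_
  rw [mul_pointIdem_apply, ite_eq_left_iff]
  intro hy
  by_cases hn : p ∣ n
  · rw [(hp.2 n).2 hn] at hy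
    exact (inflate_apply_ne hp f n hy).symm
  · rw [inflate_apply_of_not_dvd hp f hn, ContinuousMap.zero_apply]

/-- The left factor keeps only the value at `x`, the right one only degrees `n` with `σⁿ x = x`,
that is, `p ∣ n`. -/
theorem pointIdem_mul_mul_pointIdem (hp : IsPeriod σ x p) (a : EllOne σ) :
    pointIdem σ x * a * pointIdem σ x = inflate σ x hp (compress σ x hp a) := by
  classical
  refine EllOne.ext fun n => ContinuousMap.ext fun y => ?_
  rw [mul_pointIdem_apply, pointIdem_mul_apply]
  by_cases hy : y = x
  · subst hy
    by_cases hn : p ∣ n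
    · rw [(hp.2 n).2 hn, if_pos rfl, if_pos rfl]
      obtain ⟨k, rfl⟩ := hn
      rw [inflate_apply_mul, compress_apply, ContinuousMap.smul_apply, indicatorPt_apply,
        if_pos rfl, smul_eq_mul, mul_one]
    · rw [inflate_apply_of_not_dvd hp _ hn, ContinuousMap.zero_apply,
        if_neg fun h => hn ((hp.2 n).1 h.symm)]
  · rw [if_neg hy, ite_self, inflate_apply_ne hp _ n hy]

/-- Compression is not multiplicative in general; the inserted idempotent removes the terms of the
convolution whose degree is not a multiple of `p`, and the rest is an untwisted convolution because
`σ^(pj)` fixes `x`. -/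
theorem compress_mul_pointIdem_mul (hp : IsPeriod σ x p) (a b : EllOne σ) :
    compress σ x hp (a * pointIdem σ x * b) = compress σ x hp a * compress σ x hp b := by
  classical
  refine WienerAlgebra.ext' fun m => ?_
  rw [compress_apply, ← (hasSum_mul_apply _ b (p * m) x).tsum_eq,
    ← (WienerAlgebra.hasSum_mul_coeff _ _ m).tsum_eq]
  have hoff : ∀ k ∉ Set.range fun j : ℤ => p * j,
      (a * pointIdem σ x) k x * b (p * m - k) ((σ ^ (-k) : X ≃ₜ X) x) = 0 := fun k hk => by
    rw [mul_pointIdem_apply, if_neg, zero_mul]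
    intro h
    obtain ⟨j, rfl⟩ := (hp.2 k).1 h.symm
    exact hk ⟨j, rfl⟩
  rw [← (mul_right_injective₀ hp.1).tsum_eq (Function.support_subset_iff'.2 hoff)]
  refine tsum_congr fun j => ?_
  rw [mul_pointIdem_apply, if_pos ((hp.2 _).2 ⟨j, rfl⟩).symm,
    (hp.2 (-(p * j))).2 (dvd_neg.2 ⟨j, rfl⟩), compress_apply, compress_apply, mul_sub]

theorem compress_mul_inflate_mul (hp : IsPeriod σ x p) (a b : EllOne σ) (f : WienerAlgebra) :
    compress σ x hp (a * inflate σ x hp f * b) = compress σ x hp a * f * compress σ x hp b := by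
  rw [← inflate_mul_pointIdem, ← mul_assoc, compress_mul_pointIdem_mul, ← pointIdem_mul_inflate,
    ← mul_assoc, compress_mul_pointIdem_mul, compress_inflate]

theorem inflate_one (hp : IsPeriod σ x p) : inflate σ x hp 1 = pointIdem σ x := by
  rw [← compress_one hp, ← pointIdem_mul_mul_pointIdem, mul_one, pointIdem, single_mul_single,
    alphaPow_zero, add_zero]
  congr 1
  ext y
  rw [ContinuousMap.mul_apply, indicatorPt_apply]
  split_ifs <;> simp

/-- The product lies in the corner, so it is recovered from its compression. -/
theorem inflate_mul (hp : IsPeriod σ x p) (f g : WienerAlgebra) :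
    inflate σ x hp (f * g) = inflate σ x hp f * inflate σ x hp g := by
  have h := pointIdem_mul_mul_pointIdem hp (inflate σ x hp f * inflate σ x hp g)
  rw [← mul_assoc, pointIdem_mul_inflate, mul_assoc, inflate_mul_pointIdem] at h
  rw [h, ← one_mul (inflate σ x hp f), compress_mul_inflate_mul, compress_one, one_mul,
    compress_inflate]

/-- Off the orbit of `x`, point idempotents are killed by the compression to `x`. -/
theorem compress_mul_pointIdem_mul_of_notMem (hp : IsPeriod σ x p) {y : X}
    (hy : ∀ n : ℤ, x ≠ (σ ^ n : X ≃ₜ X) y) (a b : EllOne σ) :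
    compress σ x hp (a * pointIdem σ y * b) = 0 := by
  refine WienerAlgebra.ext' fun m => ?_
  rw [compress_apply, ← (hasSum_mul_apply _ b (p * m) x).tsum_eq]
  refine Eq.trans (tsum_congr fun k => ?_) tsum_zero
  rw [mul_pointIdem_apply, if_neg (hy k), zero_mul]

end Isotropy

end EllOne


/-! ### The structure space of a finite system -/

namespace EllOne

section Primitive

variable {X : Type u} [TopologicalSpace X] [CompactSpace X]
  {σ : X ≃ₜ X} {x : X} {p : ℤ}

/-- The functional `a ↦ ∑ₖ a(pk)(x) zᵏ`. -/
def evalAt (hp : IsPeriod σ x p) (z : Circle) : EllOne σ →ₗ[ℂ] ℂ :=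
  (WienerAlgebra.eval z).comp (compress σ x hp)

theorem evalAt_apply (hp : IsPeriod σ x p) (z : Circle) (a : EllOne σ) :
    evalAt hp z a = WienerAlgebra.eval z (compress σ x hp a) := rfl

theorem evalAt_one (hp : IsPeriod σ x p) (z : Circle) : evalAt hp z 1 = 1 := by
  rw [evalAt_apply, compress_one, WienerAlgebra.eval_one]

variable [T1Space X] [Finite X]

theorem evalAt_mul_inflate_mul (hp : IsPeriod σ x p) (z : Circle) (f : WienerAlgebra)
    (a b : EllOne σ) : evalAt hp z (a * inflate σ x hp f * b) =
      evalAt hp z a * WienerAlgebra.eval z f * evalAt hp z b := by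
  rw [evalAt_apply, compress_mul_inflate_mul, WienerAlgebra.eval_mul, WienerAlgebra.eval_mul]
  rfl

theorem evalAt_mul_pointIdem_mul (hp : IsPeriod σ x p) (z : Circle) (a b : EllOne σ) :
    evalAt hp z (a * pointIdem σ x * b) = evalAt hp z a * evalAt hp z b := by
  rw [evalAt_apply, compress_mul_pointIdem_mul, WienerAlgebra.eval_mul]
  rfl

/-- The primitive ideal of `ℓ¹(Σ)` attached to the orbit of `x` and a point of the circle. -/
def primitiveAt (hp : IsPeriod σ x p) (z : Circle) : StructureSpace (EllOne σ) :=
  primitiveOfFunctional (evalAt hp z) (pointIdem σ x) (evalAt_one hp z)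
    (evalAt_mul_pointIdem_mul hp z)

theorem mem_primitiveAt (hp : IsPeriod σ x p) (z : Circle) (a : EllOne σ) :
    a ∈ (primitiveAt hp z).1 ↔ ∀ b c, evalAt hp z (b * a * c) = 0 :=
  mem_primitiveOfFunctional

theorem inflate_mem_primitiveAt_iff (hp : IsPeriod σ x p) (z : Circle) (f : WienerAlgebra) :
    inflate σ x hp f ∈ (primitiveAt hp z).1 ↔ WienerAlgebra.eval z f = 0 := by
  rw [mem_primitiveAt]
  simp_rw [evalAt_mul_inflate_mul]
  constructor
  · intro h
    simpa [evalAt_one] using h 1 1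
  · intro h b c
    rw [h, mul_zero, zero_mul]

theorem inflate_mem_primitiveAt_of_notMem {y : X} {q : ℤ} (hp : IsPeriod σ x p)
    (hq : IsPeriod σ y q) (hxy : ∀ n : ℤ, y ≠ (σ ^ n : X ≃ₜ X) x) (z : Circle)
    (f : WienerAlgebra) : inflate σ x hp f ∈ (primitiveAt hq z).1 := by
  rw [mem_primitiveAt]
  intro b c
  rw [← pointIdem_mul_inflate, ← mul_assoc, mul_assoc, evalAt_apply,
    compress_mul_pointIdem_mul_of_notMem hq hxy, map_zero]

/-- The primitive ideals not containing the idempotent of `x` are those attached to `x`. -/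
theorem exists_eq_primitiveAt (hp : IsPeriod σ x p) {E : Type*} [AddCommGroup E] [Module ℂ E]
    {π : EllOne σ →ₙₐ[ℂ] Module.End ℂ E} (hπ : IsAlgebraicallyIrreducible π)
    (hx : π (pointIdem σ x) ≠ 0) :
    ∃ z, TwoSidedIdeal.ker π = (primitiveAt hp z).1 := by
  obtain ⟨v₀, hv₀⟩ : ∃ v, π (pointIdem σ x) v ≠ 0 := by
    by_contra! h
    exact hx (LinearMap.ext h)
  have hee : pointIdem σ x * pointIdem σ x = pointIdem σ x := by
    rw [← inflate_one hp, ← inflate_mul, mul_one]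
  obtain ⟨v, hv, hev⟩ : ∃ v, v ≠ 0 ∧ π (pointIdem σ x) v = v :=
    ⟨_, hv₀, by rw [← Module.End.mul_apply, ← map_mul, hee]⟩
  -- The annihilator of `v` in the corner.
  let I : Ideal WienerAlgebra :=
    { carrier := {f | π (inflate σ x hp f) v = 0}
      add_mem' := fun {f g} hf hg => by
        rw [Set.mem_ofPred_eq] at hf hg ⊢
        rw [map_add, map_add, LinearMap.add_apply, hf, hg, add_zero]
      zero_mem' := by
        rw [Set.mem_ofPred_eq, map_zero, map_zero, LinearMap.zero_apply]
      smul_mem' := fun f g hg => by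
        rw [Set.mem_ofPred_eq] at hg ⊢
        rw [smul_eq_mul, inflate_mul, map_mul, Module.End.mul_apply, hg, map_zero] }
  have hI : ∀ f, f ∈ I ↔ π (inflate σ x hp f) v = 0 := fun _ => Iff.rfl
  have hmax : I.IsMaximal := by
    refine Ideal.isMaximal_iff.2 ⟨?_, fun J f hIJ hf hfJ => ?_⟩
    · rw [hI, inflate_one, hev]
      exact hv
    · rw [hI] at hf
      -- Cyclicity of `π(f) v` brings it back to `v`; the compression of `a` then inverts `f` modulo
      -- `I`.
      obtain ⟨a, ha⟩ := hπ.exists_apply_eq hf v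
      have h1 : compress σ x hp a * f - 1 ∈ I := by
        rw [hI, map_sub, map_sub, LinearMap.sub_apply, inflate_one, hev, inflate_mul,
          ← pointIdem_mul_mul_pointIdem, mul_assoc, pointIdem_mul_inflate, map_mul, map_mul,
          Module.End.mul_apply, Module.End.mul_apply, ha, hev, sub_self]
      have h2 := J.sub_mem (J.mul_mem_left (compress σ x hp a) hfJ) (hIJ h1)
      rwa [sub_sub_cancel] at h2
  -- Gelfand–Mazur. Maximal ideals of a Banach algebra are automatically closed, so no topology on
  -- `E` is needed.
  obtain ⟨z, hz⟩ := WienerAlgebra.exists_eq_eval I.toCharacterSpace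
  have hker : ∀ f, WienerAlgebra.eval z f = 0 → f ∈ I := by
    let K : Ideal WienerAlgebra := RingHom.ker I.toCharacterSpace
    have hIK : I ≤ K := fun f hf => I.toCharacterSpace_apply_eq_zero_of_mem hf
    have hK : I = K := hmax.eq_of_le (RingHom.ker_ne_top _) hIK
    intro f hf
    rw [hK]
    exact (hz f).trans hf
  have hscal : ∀ f, π (inflate σ x hp f) v = WienerAlgebra.eval z f • v := fun f => by
    have h := hker (f - WienerAlgebra.eval z f • 1) (by
      rw [map_sub, map_smul, WienerAlgebra.eval_one, smul_eq_mul, mul_one, sub_self])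
    rw [hI, map_sub, map_sub, map_smul, map_smul, inflate_one, LinearMap.sub_apply,
      LinearMap.smul_apply, hev] at h
    exact sub_eq_zero.1 h
  refine ⟨z, TwoSidedIdeal.ext fun a => ?_⟩
  rw [TwoSidedIdeal.mem_ker, mem_primitiveAt]
  refine hπ.map_eq_zero_iff hv hev (fun b => ?_) a
  rw [pointIdem_mul_mul_pointIdem hp, hscal]
  rfl

end Primitive

/-! ### Orbits, circle points and the homeomorphism. -/

section Classification

variable {X : Type u} [TopologicalSpace X] {σ : X ≃ₜ X}

/-- A point of an orbit. -/
def orbitPt (o : OrbitSet σ) : X := o.2.choose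

theorem orbit_eq (o : OrbitSet σ) : o.1 = Set.range fun n : ℤ => (σ ^ n : X ≃ₜ X) (orbitPt o) :=
  o.2.choose_spec

theorem eq_of_orbitPt_eq {o o' : OrbitSet σ} {n : ℤ}
    (h : orbitPt o' = (σ ^ n : X ≃ₜ X) (orbitPt o)) : o = o' := by
  refine Subtype.ext ?_
  rw [orbit_eq, orbit_eq, h]
  ext y
  constructor
  · rintro ⟨m, rfl⟩
    exact ⟨m - n, by simp only; rw [← zpow_add_apply, sub_add_cancel]⟩
  · rintro ⟨m, rfl⟩
    exact ⟨m + n, by simp only; rw [← zpow_add_apply]⟩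

theorem exists_zpow_orbitPt (σ : X ≃ₜ X) (y : X) :
    ∃ (o : OrbitSet σ) (n : ℤ), y = (σ ^ n : X ≃ₜ X) (orbitPt o) := by
  let o : OrbitSet σ := ⟨_, y, rfl⟩
  have hy : y ∈ o.1 := ⟨0, zpow_zero_apply σ y⟩
  rw [orbit_eq] at hy
  obtain ⟨n, hn⟩ := hy
  exact ⟨o, n, hn.symm⟩

variable [Finite X]

/-- A period of the chosen point of an orbit. -/
def orbitPeriod (o : OrbitSet σ) : ℤ := (exists_isPeriod σ (orbitPt o)).choose

theorem isPeriod_orbitPeriod (o : OrbitSet σ) : IsPeriod σ (orbitPt o) (orbitPeriod o) :=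
  (exists_isPeriod σ (orbitPt o)).choose_spec

variable [CompactSpace X] [T1Space X]

/-- The primitive ideal attached to an orbit and a point of the circle. -/
def primitiveOfOrbit (q : Σ _ : OrbitSet σ, Circle) : StructureSpace (EllOne σ) :=
  primitiveAt (isPeriod_orbitPeriod q.1) q.2

/-- If the idempotents of the chosen orbit points were all killed, conjugacy and their sum being `1`
would force `π 1 = 0`. -/
theorem primitiveOfOrbit_surjective : Function.Surjective (primitiveOfOrbit (σ := σ)) := by
  rintro ⟨P, E, _, _, π, hπ, rfl⟩
  obtain ⟨o, ho⟩ : ∃ o : OrbitSet σ, π (pointIdem σ (orbitPt o)) ≠ 0 := by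
    by_contra! h
    have h0 : ∀ y, π (pointIdem σ y) = 0 := fun y => by
      obtain ⟨o, n, rfl⟩ := exists_zpow_orbitPt σ y
      rw [pointIdem_zpow, map_mul, map_mul, h, mul_zero, zero_mul]
    have := Fintype.ofFinite X
    have h1 : π 1 = 0 := by
      rw [← sum_pointIdem, map_sum]
      exact Finset.sum_eq_zero fun y _ => h0 y
    obtain ⟨a, v, hav⟩ := hπ.nonzero
    rw [← mul_one a, map_mul, h1, mul_zero] at hav
    exact hav rfl
  obtain ⟨z, hz⟩ := exists_eq_primitiveAt (isPeriod_orbitPeriod o) hπ ho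
  exact ⟨⟨o, z⟩, Subtype.ext hz.symm⟩

/-- Closed subsets of the disjoint union of circles are separated from points by `ℓ¹(Σ)`. -/
theorem exists_mem_primitiveOfOrbit {S : Set (Σ _ : OrbitSet σ, Circle)} (hS : IsClosed S)
    {q : Σ _ : OrbitSet σ, Circle} (hq : q ∉ S) :
    ∃ a, (∀ r ∈ S, a ∈ (primitiveOfOrbit r).1) ∧ a ∉ (primitiveOfOrbit q).1 := by
  obtain ⟨o, z⟩ := q
  -- Only the slice of `S` over `o` matters: an element inflated at `o` lies in every primitive
  -- ideal of the other orbits.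
  obtain ⟨f, hf, hfz⟩ := WienerAlgebra.exists_eval_eq_zero_of_isClosed
    (isClosed_sigma_iff.1 hS o) (z := z) hq
  refine ⟨inflate σ _ (isPeriod_orbitPeriod o) f, ?_, fun h =>
    hfz ((inflate_mem_primitiveAt_iff _ _ _).1 h)⟩
  rintro ⟨o', w⟩ hw
  by_cases ho : o = o'
  · subst ho
    exact (inflate_mem_primitiveAt_iff _ _ _).2 (hf w hw)
  · exact inflate_mem_primitiveAt_of_notMem _ _ (fun n hn => ho (eq_of_orbitPt_eq hn)) _ _

theorem primitiveOfOrbit_injective : Function.Injective (primitiveOfOrbit (σ := σ)) := by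
  intro q r hqr
  by_contra hne
  obtain ⟨a, ha, hn⟩ := exists_mem_primitiveOfOrbit (isClosed_singleton (x := r)) (q := q) hne
  rw [hqr] at hn
  exact hn (ha r rfl)

theorem isClosedMap_primitiveOfOrbit : IsClosedMap (primitiveOfOrbit (σ := σ)) := by
  intro S hS
  rw [StructureSpace.isClosed_iff]
  intro P hP
  obtain ⟨q, rfl⟩ := primitiveOfOrbit_surjective P
  refine ⟨q, ?_, rfl⟩
  by_contra hq
  obtain ⟨a, ha, hn⟩ := exists_mem_primitiveOfOrbit hS hq
  refine hn (hP (StructureSpace.mem_kernel.2 ?_))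
  rintro _ ⟨r, hr, rfl⟩
  exact ha r hr

/-- On each circle, the preimage of a hull is an intersection of zero sets of the continuous
functions `z ↦ φ_z(b a c)`. -/
theorem continuous_primitiveOfOrbit : Continuous (primitiveOfOrbit (σ := σ)) := by
  refine continuous_sigma fun o => continuous_iff_isClosed.2 fun C hC => ?_
  have h : (fun z => primitiveOfOrbit ⟨o, z⟩) ⁻¹' C =
      {z | ∀ a ∈ StructureSpace.kernel C, ∀ b c,
        evalAt (isPeriod_orbitPeriod o) z (b * a * c) = 0} := by
    ext z
    constructor
    · exact fun hz a ha => (mem_primitiveAt _ _ _).1 (StructureSpace.mem_kernel.1 ha _ hz)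
    · exact fun hz => StructureSpace.isClosed_iff.1 hC
        fun a ha => (mem_primitiveAt _ _ _).2 (hz a ha)
  rw [h]
  simp only [Set.ofPred_forall]
  exact isClosed_iInter fun a => isClosed_iInter fun _ => isClosed_iInter fun b =>
    isClosed_iInter fun c => isClosed_eq (WienerAlgebra.continuous_eval _) continuous_const

end Classification

end EllOne

end

theorem mainTheorem9 {X : Type u} [TopologicalSpace X] [CompactSpace X] [T2Space X] [Nonempty X]
    [Finite X] (σ : X ≃ₜ X) :
    Nonempty (StructureSpace (EllOne σ) ≃ₜ (Σ _ : OrbitSet σ, Circle)) :=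
  ⟨((Equiv.ofBijective EllOne.primitiveOfOrbit ⟨EllOne.primitiveOfOrbit_injective,
    EllOne.primitiveOfOrbit_surjective⟩).toHomeomorphOfContinuousClosed
      EllOne.continuous_primitiveOfOrbit EllOne.isClosedMap_primitiveOfOrbit).symm⟩
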